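/- Let $R$ be a commutative Noetherian ring, and let $C$ be a semidualizing $R$-module, i.e. a finitely generated $R$-module such that the homothety map $R\to \mathrm{Hom}_R(C,C)$ is an isomorphism and $\mathrm{Ext}^i_R(C,C)=0$ for all $i>0$. For $R$-modules $M,N$, let $\mathrm{Ext}^i_{\mathscr P_C}(M,N)$ be the $i$-th cohomology module of $\mathrm{Hom}_R(L,N)$, where $L$ is a proper $\mathscr P_C$-projective resolution of $M$, that is, a complex $\cdots\to C\otimes_R P_1\to C\otimes_R P_0\to 0$ with all $P_n$ projective, together with a map $C\otimes_R P_0\to M$ such that $\cdots\to C\otimes_R P_1\to C\otimes_R P_0\to M\to 0$ is a complex that becomes exact after applying $\mathrm{Hom}_R(C,-)$. Let $\mathrm{Ext}^i_{\mathscr I_C}(M,N)$ be the $i$-th cohomology module of $\mathrm{Hom}_R(M,J)$, where $J$ is a proper $\mathscr I_C$-injective resolution of $N$, that is, a complex $0\to \mathrm{Hom}_R(C,I^0)\to \mathrm{Hom}_R(C,I^1)\to\cdots$ with all $I^n$ injective, together with a map $N\to \mathrm{Hom}_R(C,I^0)$ such that $0\to N\to \mathrm{Hom}_R(C,I^0)\to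 \mathrm{Hom}_R(C,I^1)\to\cdots$ is a complex that becomes exact after applying $C\otimes_R-$. Such resolutions exist for every module, and the relative Ext modules do not depend on their choice up to isomorphism. Write $[C]\approx[R]$ if there is a finitely generated projective $R$-module $P$ of rank $1$ with $R\cong C\otimes_R P$. The following conditions are equivalent, where $\cong$ denotes isomorphism of $R$-modules: (i) $[C]\approx[R]$. (i′) $C$ is projective. (ii) $\mathrm{Ext}^i_{\mathscr P_C}(M,N)\cong \mathrm{Ext}^i_{\mathscr I_C}(M,N)$ for all $R$-modules $M$ and $N$ and all $i\ge 0$. (iii) $\mathrm{Ext}^i_{\mathscr P_C}(C,R/\mathfrak m)\cong \mathrm{Ext}^i_{\mathscr I_C}(C,R/\mathfrak m)$ for all maximal ideals $\mathfrak m$ of $R$ and all $i\ge 0$. (iv) $\mathrm{Ext}^0_{\mathscr P_C}(C,R/\mathfrak m)\cong \mathrm{Ext}^0_{\mathscr I_C}(C,R/\mathfrak m)$ for all maximal ideals $\mathfrak m$ of $R$. (v) $\mathrm{Ext}^i_{\mathscr P_C}(M,N)\cong \mathrm{Ext}^i_R(M,N)$ for all $R$-modules $M$ and $N$ and all $i\ge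 0$. (vi) $\mathrm{Ext}^i_{\mathscr P_C}(C,R/\mathfrak m)\cong \mathrm{Ext}^i_R(C,R/\mathfrak m)$ for all maximal ideals $\mathfrak m$ of $R$ and all $i\ge 0$. (vii) $\mathrm{Ext}^i_{\mathscr I_C}(M,N)\cong \mathrm{Ext}^i_R(M,N)$ for all $R$-modules $M$ and $N$ and all $i\ge 0$. (viii) $\mathrm{Ext}^i_{\mathscr I_C}(C,R/\mathfrak m)\cong \mathrm{Ext}^i_R(C,R/\mathfrak m)$ for all maximal ideals $\mathfrak m$ of $R$ and all $i\ge 0$. -/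

import Mathlib

universe u

open CategoryTheory TensorProduct

noncomputable section

namespace RelExt

variable {R : Type u} [CommRing R]

/-- A finitely generated `R`-module `C` is *semidualizing* if the homothety map
`R → Hom_R(C, C)` is an isomorphism and `Ext^i_R(C, C) = 0` for all `i > 0`. -/
structure IsSemidualizing (C : ModuleCat.{u} R) : Prop where
  finite : Module.Finite R C
  homothety_bijective : Function.Bijective (LinearMap.lsmul R C : R →ₗ[R] C →ₗ[R] C)
  ext_eq_zero : ∀ i : ℕ, 0 < i → Subsingleton (Abelian.Ext C C i)

/-- The relation `[B] ≈ [C]` induced by the action of the Picard group: `C ≅ B ⊗ P` for some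
finitely generated projective module `P` of rank `1`. -/
def PicEquiv (B C : ModuleCat.{u} R) : Prop :=
  ∃ P : ModuleCat.{u} R, Module.Finite R P ∧ Module.Projective R P ∧
    (∀ p : PrimeSpectrum R, Module.rankAtStalk (R := R) P p = 1) ∧
    Nonempty (C ≃ₗ[R] B ⊗[R] P)

/-- `C`-projective modules: those isomorphic to `C ⊗ P` with `P` projective. -/
def IsCProjective (C X : ModuleCat.{u} R) : Prop :=
  ∃ P : ModuleCat.{u} R, Module.Projective R P ∧ Nonempty (X ≃ₗ[R] C ⊗[R] P)

/-- `C`-injective modules: those isomorphic to `Hom_R(C, I)` with `I` injective. -/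
def IsCInjective (C X : ModuleCat.{u} R) : Prop :=
  ∃ I : ModuleCat.{u} R, Module.Injective R I ∧ Nonempty (X ≃ₗ[R] (C →ₗ[R] I))

/-- The map `Hom_R(C, X) → Hom_R(C, Y)` induced by `f : X ⟶ Y`. -/
abbrev homMap (C : ModuleCat.{u} R) {X Y : ModuleCat.{u} R} (f : X ⟶ Y) :
    (C →ₗ[R] X) →ₗ[R] (C →ₗ[R] Y) :=
  LinearMap.compRight R f.hom

/-- The map `C ⊗ X → C ⊗ Y` induced by `f : X ⟶ Y`. -/
abbrev tensorMap (C : ModuleCat.{u} R) {X Y : ModuleCat.{u} R} (f : X ⟶ Y) :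
    C ⊗[R] X →ₗ[R] C ⊗[R] Y :=
  LinearMap.lTensor C f.hom

/-- A proper `P_C`-projective resolution of `M`: a complex `⋯ ⟶ X₁ ⟶ X₀` of `C`-projective
modules, with an augmentation `X₀ ⟶ M`, such that the augmented complex
`⋯ ⟶ X₁ ⟶ X₀ ⟶ M ⟶ 0` becomes exact after applying `Hom_R(C, -)`. -/
structure ProperProjResolution (C M : ModuleCat.{u} R) where
  complex : ChainComplex (ModuleCat.{u} R) ℕ
  isCProjective : ∀ n, IsCProjective C (complex.X n)
  augmentation : complex.X 0 ⟶ M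
  d_comp_augmentation : complex.d 1 0 ≫ augmentation = 0
  surjective : Function.Surjective (homMap C augmentation)
  exact_zero : Function.Exact (homMap C (complex.d 1 0)) (homMap C augmentation)
  exact_succ : ∀ n, Function.Exact (homMap C (complex.d (n + 2) (n + 1)))
    (homMap C (complex.d (n + 1) n))

/-- A proper `I_C`-injective resolution of `N`: a complex `Y⁰ ⟶ Y¹ ⟶ ⋯` of `C`-injective
modules, with a coaugmentation `N ⟶ Y⁰`, such that the augmented complex
`0 ⟶ N ⟶ Y⁰ ⟶ Y¹ ⟶ ⋯` becomes exact after applying `C ⊗ -`. -/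
structure ProperInjResolution (C N : ModuleCat.{u} R) where
  cocomplex : CochainComplex (ModuleCat.{u} R) ℕ
  isCInjective : ∀ n, IsCInjective C (cocomplex.X n)
  coaugmentation : N ⟶ cocomplex.X 0
  coaugmentation_comp_d : coaugmentation ≫ cocomplex.d 0 1 = 0
  injective : Function.Injective (tensorMap C coaugmentation)
  exact_zero : Function.Exact (tensorMap C coaugmentation) (tensorMap C (cocomplex.d 0 1))
  exact_succ : ∀ n, Function.Exact (tensorMap C (cocomplex.d n (n + 1)))
    (tensorMap C (cocomplex.d (n + 1) (n + 2)))

section Existence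

variable (C : ModuleCat.{u} R)

/-- The `C`-projective module `C ⊗ R^(Hom(C, K))`. -/
def projCover (K : ModuleCat.{u} R) : ModuleCat.{u} R :=
  ModuleCat.of R (C ⊗[R] ((C →ₗ[R] K) →₀ R))

/-- The evaluation map `C ⊗ R^(Hom(C, K)) → K`, sending `c ⊗ f` to `f c`. -/
def projEval (K : ModuleCat.{u} R) : C ⊗[R] ((C →ₗ[R] K) →₀ R) →ₗ[R] K :=
  TensorProduct.lift
    (LinearMap.flip (Finsupp.linearCombination R (id : (C →ₗ[R] K) → (C →ₗ[R] K))))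

lemma projEval_tmul_single (K : ModuleCat.{u} R) (c : C) (f : C →ₗ[R] K) :
    projEval C K (c ⊗ₜ[R] Finsupp.single f (1 : R)) = f c := by
  simp [projEval]

/-- The evaluation map as a morphism. -/
def projCoverMap (K : ModuleCat.{u} R) : projCover C K ⟶ K :=
  ModuleCat.ofHom (projEval C K)

lemma isCProjective_projCover (K : ModuleCat.{u} R) : IsCProjective C (projCover C K) :=
  ⟨ModuleCat.of R ((C →ₗ[R] K) →₀ R),
    (inferInstance : Module.Projective R ((C →ₗ[R] K) →₀ R)), ⟨LinearEquiv.refl R _⟩⟩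

lemma projCoverMap_surjective (K : ModuleCat.{u} R) :
    Function.Surjective (homMap C (projCoverMap C K)) := by
  intro f
  refine ⟨(TensorProduct.mk R C ((C →ₗ[R] K) →₀ R)).flip (Finsupp.single f 1), ?_⟩
  exact LinearMap.ext fun c => projEval_tmul_single C K c f

/-- The kernel of the evaluation map. -/
def projKer (K : ModuleCat.{u} R) : ModuleCat.{u} R :=
  ModuleCat.of R (LinearMap.ker (projCoverMap C K).hom)

/-- The inclusion of the kernel of the evaluation map. -/
def projKerIncl (K : ModuleCat.{u} R) : projKer C K ⟶ projCover C K :=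
  ModuleCat.ofHom (LinearMap.ker (projCoverMap C K).hom).subtype

/-- One step of the canonical proper resolution. -/
def projStep (K : ModuleCat.{u} R) : projCover C (projKer C K) ⟶ projCover C K :=
  projCoverMap C (projKer C K) ≫ projKerIncl C K

lemma projKerIncl_comp (K : ModuleCat.{u} R) : projKerIncl C K ≫ projCoverMap C K = 0 := by
  ext x
  exact x.2

lemma projStep_comp_map (K : ModuleCat.{u} R) : projStep C K ≫ projCoverMap C K = 0 := by
  rw [projStep, Category.assoc, projKerIncl_comp, Limits.comp_zero]

lemma projStep_comp (K : ModuleCat.{u} R) : projStep C (projKer C K) ≫ projStep C K = 0 := by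
  rw [projStep.eq_def C K, ← Category.assoc, projStep_comp_map, Limits.zero_comp]

lemma homMap_projStep_exact (K : ModuleCat.{u} R) :
    Function.Exact (homMap C (projStep C K)) (homMap C (projCoverMap C K)) := by
  intro f
  constructor
  · intro hf
    have hf' : ∀ c, (projCoverMap C K).hom (f c) = 0 := fun c =>
      LinearMap.congr_fun hf c
    obtain ⟨g, hg⟩ := projCoverMap_surjective C (projKer C K)
      (LinearMap.codRestrict (LinearMap.ker (projCoverMap C K).hom) f hf')
    refine ⟨g, LinearMap.ext fun c => ?_⟩
    exact congrArg Subtype.val (LinearMap.congr_fun hg c)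
  · rintro ⟨g, rfl⟩
    apply LinearMap.ext
    intro c
    exact LinearMap.congr_fun (congrArg ModuleCat.Hom.hom (projStep_comp_map C K)) (g c)

lemma homMap_projStep_exact' (K : ModuleCat.{u} R) :
    Function.Exact (homMap C (projStep C (projKer C K))) (homMap C (projStep C K)) := by
  intro f
  refine Iff.trans ?_ (homMap_projStep_exact C (projKer C K) f)
  constructor
  · intro hf
    apply LinearMap.ext
    intro c
    exact Subtype.ext (LinearMap.congr_fun hf c)
  · intro hf
    apply LinearMap.ext
    intro c
    exact congrArg Subtype.val (LinearMap.congr_fun hf c)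

/-- Iterated syzygies. -/
def projSyz (M : ModuleCat.{u} R) : ℕ → ModuleCat.{u} R
  | 0 => M
  | n + 1 => projKer C (projSyz M n)

lemma nonempty_properProjResolution_of {M : ModuleCat.{u} R} (X : ℕ → ModuleCat.{u} R)
    (d : ∀ n, X (n + 1) ⟶ X n) (sq : ∀ n, d (n + 1) ≫ d n = 0)
    (hX : ∀ n, IsCProjective C (X n)) (ε : X 0 ⟶ M) (hε : d 0 ≫ ε = 0)
    (hs : Function.Surjective (homMap C ε))
    (h₀ : Function.Exact (homMap C (d 0)) (homMap C ε))
    (h : ∀ n, Function.Exact (homMap C (d (n + 1))) (homMap C (d n))) :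
    Nonempty (ProperProjResolution C M) := by
  have hd : ∀ n, (ChainComplex.of X d sq).d (n + 1) n = d n := fun n => ChainComplex.of_d X d n
  refine ⟨⟨ChainComplex.of X d sq, hX, ε, ?_, hs, ?_, fun n => ?_⟩⟩
  · exact (congrArg (fun f : X 1 ⟶ X 0 => f ≫ ε) (hd 0)).trans hε
  · exact (congrArg (fun f : X 1 ⟶ X 0 =>
      Function.Exact (homMap C f) (homMap C ε)) (hd 0)).mpr h₀
  · exact (congrArg₂ (fun (f : X (n + 2) ⟶ X (n + 1)) (g : X (n + 1) ⟶ X n) =>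
      Function.Exact (homMap C f) (homMap C g)) (hd (n + 1)) (hd n)).mpr (h n)

/-- Every module has a proper `P_C`-projective resolution. -/
instance nonempty_properProjResolution (M : ModuleCat.{u} R) :
    Nonempty (ProperProjResolution C M) :=
  nonempty_properProjResolution_of C (fun n => projCover C (projSyz C M n))
    (fun n => projStep C (projSyz C M n)) (fun n => projStep_comp C (projSyz C M n))
    (fun n => isCProjective_projCover C (projSyz C M n)) (projCoverMap C M)
    (projStep_comp_map C M) (projCoverMap_surjective C M) (homMap_projStep_exact C M)
    (fun n => homMap_projStep_exact' C (projSyz C M n))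

/-- The `C`-injective module `Hom(C, I)`, where `I` is an injective module containing `C ⊗ K`. -/
def injHull (K : ModuleCat.{u} R) : ModuleCat.{u} R :=
  ModuleCat.of R (C →ₗ[R] (Injective.under (ModuleCat.of R (C ⊗[R] K)) : ModuleCat.{u} R))

/-- The map `K ⟶ Hom(C, I)` adjoint to the inclusion `C ⊗ K ⟶ I`. -/
def injHullMap (K : ModuleCat.{u} R) : K ⟶ injHull C K :=
  ModuleCat.ofHom (TensorProduct.curry
    ((Injective.ι (ModuleCat.of R (C ⊗[R] K))).hom)).flip

lemma isCInjective_injHull (K : ModuleCat.{u} R) : IsCInjective C (injHull C K) :=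
  ⟨Injective.under (ModuleCat.of R (C ⊗[R] K)),
    (Module.injective_iff_injective_object R
      (Injective.under (ModuleCat.of R (C ⊗[R] K)) : ModuleCat.{u} R)).2
        (Injective.injective_under (ModuleCat.of R (C ⊗[R] K))), ⟨LinearEquiv.refl R _⟩⟩

lemma injHullMap_injective (K : ModuleCat.{u} R) :
    Function.Injective (tensorMap C (injHullMap C K)) := by
  let J : ModuleCat.{u} R := Injective.under (ModuleCat.of R (C ⊗[R] K))
  let ev : C ⊗[R] (C →ₗ[R] J) →ₗ[R] J := TensorProduct.lift (LinearMap.id.flip)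
  have h : ev ∘ₗ tensorMap C (injHullMap C K) =
      (Injective.ι (ModuleCat.of R (C ⊗[R] K))).hom := by
    apply TensorProduct.ext'
    intro c k
    rfl
  have hinj : Function.Injective (Injective.ι (ModuleCat.of R (C ⊗[R] K))).hom :=
    (ModuleCat.mono_iff_injective _).1 inferInstance
  rw [← h] at hinj
  exact Function.Injective.of_comp hinj

/-- The cokernel of `K ⟶ Hom(C, I)`. -/
def injCoker (K : ModuleCat.{u} R) : ModuleCat.{u} R :=
  ModuleCat.of R (injHull C K ⧸ LinearMap.range (injHullMap C K).hom)

/-- The projection onto the cokernel. -/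
def injCokerProj (K : ModuleCat.{u} R) : injHull C K ⟶ injCoker C K :=
  ModuleCat.ofHom (LinearMap.range (injHullMap C K).hom).mkQ

/-- One step of the canonical proper coresolution. -/
def injStep (K : ModuleCat.{u} R) : injHull C K ⟶ injHull C (injCoker C K) :=
  injCokerProj C K ≫ injHullMap C (injCoker C K)

lemma injHullMap_comp_proj (K : ModuleCat.{u} R) : injHullMap C K ≫ injCokerProj C K = 0 := by
  ext x
  exact (Submodule.Quotient.mk_eq_zero _).2 ⟨x, rfl⟩

lemma map_comp_injStep (K : ModuleCat.{u} R) : injHullMap C K ≫ injStep C K = 0 := by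
  rw [injStep, ← Category.assoc, injHullMap_comp_proj, Limits.zero_comp]

lemma injStep_comp (K : ModuleCat.{u} R) : injStep C K ≫ injStep C (injCoker C K) = 0 := by
  rw [injStep.eq_def C K, Category.assoc, map_comp_injStep, Limits.comp_zero]

lemma tensorMap_injStep (K : ModuleCat.{u} R) :
    tensorMap C (injStep C K) = tensorMap C (injHullMap C (injCoker C K)) ∘ₗ
      tensorMap C (injCokerProj C K) := by
  rw [injStep, tensorMap, ModuleCat.hom_comp, LinearMap.lTensor_comp]

lemma tensorMap_injStep_exact (K : ModuleCat.{u} R) :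
    Function.Exact (tensorMap C (injHullMap C K)) (tensorMap C (injStep C K)) := by
  have h : Function.Exact (tensorMap C (injHullMap C K)) (tensorMap C (injCokerProj C K)) :=
    lTensor_exact C (LinearMap.exact_map_mkQ_range _) (Submodule.mkQ_surjective _)
  intro x
  refine Iff.trans ?_ (h x)
  rw [tensorMap_injStep, LinearMap.comp_apply]
  exact map_eq_zero_iff _ (injHullMap_injective C (injCoker C K))

lemma tensorMap_injStep_exact' (K : ModuleCat.{u} R) :
    Function.Exact (tensorMap C (injStep C K)) (tensorMap C (injStep C (injCoker C K))) := by
  intro x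
  rw [tensorMap_injStep_exact C (injCoker C K) x, tensorMap_injStep]
  have hs : Function.Surjective (tensorMap C (injCokerProj C K)) :=
    LinearMap.lTensor_surjective C (Submodule.mkQ_surjective _)
  constructor
  · rintro ⟨y, rfl⟩
    obtain ⟨z, rfl⟩ := hs y
    exact ⟨z, rfl⟩
  · rintro ⟨z, rfl⟩
    exact ⟨_, rfl⟩

/-- Iterated cosyzygies. -/
def injCosyz (N : ModuleCat.{u} R) : ℕ → ModuleCat.{u} R
  | 0 => N
  | n + 1 => injCoker C (injCosyz N n)

lemma nonempty_properInjResolution_of {N : ModuleCat.{u} R} (Y : ℕ → ModuleCat.{u} R)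
    (d : ∀ n, Y n ⟶ Y (n + 1)) (sq : ∀ n, d n ≫ d (n + 1) = 0)
    (hY : ∀ n, IsCInjective C (Y n)) (η : N ⟶ Y 0) (hη : η ≫ d 0 = 0)
    (hi : Function.Injective (tensorMap C η))
    (h₀ : Function.Exact (tensorMap C η) (tensorMap C (d 0)))
    (h : ∀ n, Function.Exact (tensorMap C (d n)) (tensorMap C (d (n + 1)))) :
    Nonempty (ProperInjResolution C N) := by
  have hd : ∀ n, (CochainComplex.of Y d sq).d n (n + 1) = d n :=
    fun n => CochainComplex.of_d Y d n
  refine ⟨⟨CochainComplex.of Y d sq, hY, η, ?_, hi, ?_, fun n => ?_⟩⟩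
  · exact (congrArg (fun f : Y 0 ⟶ Y 1 => η ≫ f) (hd 0)).trans hη
  · exact (congrArg (fun f : Y 0 ⟶ Y 1 =>
      Function.Exact (tensorMap C η) (tensorMap C f)) (hd 0)).mpr h₀
  · exact (congrArg₂ (fun (f : Y n ⟶ Y (n + 1)) (g : Y (n + 1) ⟶ Y (n + 2)) =>
      Function.Exact (tensorMap C f) (tensorMap C g)) (hd n) (hd (n + 1))).mpr (h n)

/-- Every module has a proper `I_C`-injective resolution. -/
instance nonempty_properInjResolution (N : ModuleCat.{u} R) :
    Nonempty (ProperInjResolution C N) :=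
  nonempty_properInjResolution_of C (fun n => injHull C (injCosyz C N n))
    (fun n => injStep C (injCosyz C N n)) (fun n => injStep_comp C (injCosyz C N n))
    (fun n => isCInjective_injHull C (injCosyz C N n)) (injHullMap C N)
    (map_comp_injStep C N) (injHullMap_injective C N) (tensorMap_injStep_exact C N)
    (fun n => tensorMap_injStep_exact' C (injCosyz C N n))

end Existence

/-- A chosen proper `P_C`-projective resolution of `M`. -/
def properProjResolution (C M : ModuleCat.{u} R) : ProperProjResolution C M :=
  Classical.choice inferInstance

/-- A chosen proper `I_C`-injective resolution of `N`. -/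
def properInjResolution (C N : ModuleCat.{u} R) : ProperInjResolution C N :=
  Classical.choice inferInstance

/-- `Ext^n_{P_C}(M, N)`: the `n`-th cohomology module of `Hom_R(L, N)`, where `L` is a proper
`P_C`-projective resolution of `M`. -/
def ExtPC (C M N : ModuleCat.{u} R) (n : ℕ) : ModuleCat.{u} R :=
  ((properProjResolution C M).complex.linearYonedaObj R N).homology n

/-- `Ext^n_{I_C}(M, N)`: the `n`-th cohomology module of `Hom_R(M, J)`, where `J` is a proper
`I_C`-injective resolution of `N`. -/
def ExtIC (C M N : ModuleCat.{u} R) (n : ℕ) : ModuleCat.{u} R :=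
  ((((linearCoyoneda R (ModuleCat.{u} R)).obj (Opposite.op M)).mapHomologicalComplex
    (ComplexShape.up ℕ)).obj (properInjResolution C N).cocomplex).homology n

end RelExt

end

/-! ### Computing `Abelian.Ext` linearly from arbitrary resolutions. -/

namespace RelExt

variable {R : Type u} [CommRing R]

/-! If `C` is projective, then `Hom(C, C) ≅ R` gives `C* ⊗ C ≅ R`, so `C` is invertible. Then
`Hom(C, -)` and `C ⊗ -` reflect exactness, `C`-projectives are projective and `C`-injectives are
injective. Proper resolutions are thus ordinary resolutions, and both relative Ext modules agree
with `Ext` (`nonempty_extPC_linearEquiv_ext`, `nonempty_extIC_linearEquiv_ext`).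

For the converse, let `k = R/m` and `n = dim (C/mC)`. A proper `P_C`-resolution of `C` itself is
contractible, so `Ext⁰_{P_C}(C, k) = Hom(C, k)` and `Ext¹_{P_C}(C, k) = 0`. Tensor evaluation gives
`Ext⁰_{I_C}(M, N) = Hom(C ⊗ M, C ⊗ N)`. Comparing `Ext⁰_{I_C}(C, k)` with `Hom(C, k)` therefore
gives `n³ = n`, so `n ≤ 1`; a faithful finite module with cyclic fibre at `m` is free near `m`.
Comparing `Ext_{P_C}` with `Ext` in degree one gives `Ext¹(C, k) = 0`, which again forces
projectivity near `m`.

Localization is avoided: "projective near `m`" means that `s • id` lies in the image of `C* ⊗ C →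
End C` for some `s ∉ m`. -/

lemma nonempty_shortComplex_homology_linearEquiv (S : ShortComplex (ModuleCat.{u} R))
    {E : Type*} [AddCommGroup E] [Module R E] (φ : LinearMap.ker S.g.hom →ₗ[R] E)
    (hφ : Function.Surjective φ) (hker : ∀ z, φ z = 0 ↔ ∃ y, S.f.hom y = z) :
    Nonempty (S.homology ≃ₗ[R] E) := by
  have h : LinearMap.range S.moduleCatToCycles = LinearMap.ker φ := by
    ext z
    rw [LinearMap.mem_ker, hker]
    exact ⟨fun ⟨y, hy⟩ => ⟨y, congrArg Subtype.val hy⟩, fun ⟨y, hy⟩ => ⟨y, Subtype.ext hy⟩⟩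
  exact ⟨S.moduleCatHomologyIso.toLinearEquiv ≪≫ₗ Submodule.quotEquivOfEq _ _ h ≪≫ₗ
    φ.quotKerEquivOfSurjective hφ⟩

lemma nonempty_homology_succ_linearEquiv (K : CochainComplex (ModuleCat.{u} R) ℕ) (n : ℕ)
    {E : Type*} [AddCommGroup E] [Module R E]
    (φ : LinearMap.ker (K.d (n + 1) (n + 2)).hom →ₗ[R] E)
    (hφ : Function.Surjective φ) (hker : ∀ z, φ z = 0 ↔ ∃ y, (K.d n (n + 1)).hom y = z) :
    Nonempty (K.homology (n + 1) ≃ₗ[R] E) := by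
  obtain ⟨e⟩ := nonempty_shortComplex_homology_linearEquiv (K.sc' n (n + 1) (n + 2)) φ hφ hker
  exact ⟨(K.homologyIsoSc' n (n + 1) (n + 2) (by simp) (by simp)).toLinearEquiv ≪≫ₗ e⟩

lemma nonempty_homology_zero_linearEquiv (K : CochainComplex (ModuleCat.{u} R) ℕ)
    {E : Type*} [AddCommGroup E] [Module R E] (φ : E →ₗ[R] K.X 0)
    (hφ : Function.Injective φ) (hex : Function.Exact φ (K.d 0 1).hom) :
    Nonempty (K.homology 0 ≃ₗ[R] E) := by
  let e : E ≃ₗ[R] LinearMap.ker (K.d 0 1).hom :=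
    LinearEquiv.ofInjective φ hφ ≪≫ₗ LinearEquiv.ofEq _ _ hex.linearMap_ker_eq.symm
  obtain ⟨e'⟩ := nonempty_shortComplex_homology_linearEquiv (K.sc' 0 0 1) e.symm.toLinearMap
    e.symm.surjective fun z => by
      -- Nothing precedes index `0`, so its predecessor defaults to `0` itself and the incoming
      -- differential is `K.d 0 0 = 0`.
      have hd : (K.sc' 0 0 1).f = 0 := K.shape 0 0 (by simp)
      refine (LinearEquiv.map_eq_zero_iff e.symm).trans ?_
      rw [hd]
      exact ⟨fun h => ⟨0, congrArg Subtype.val h.symm⟩, fun ⟨y, hy⟩ => Subtype.ext hy.symm⟩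
  exact ⟨(K.homologyIsoSc' 0 0 1 (by simp) (by simp)).toLinearEquiv ≪≫ₗ e'⟩

lemma projectiveResolution_extMk_smul {M N : ModuleCat.{u} R} (P : ProjectiveResolution M)
    {n : ℕ} (r : R) (f : P.complex.X n ⟶ N) (m : ℕ) (hm : n + 1 = m)
    (hf : P.complex.d m n ≫ f = 0) :
    P.extMk (r • f) m hm (by rw [Linear.comp_smul, hf, smul_zero]) = r • P.extMk f m hm hf := by
  rw [Abelian.Ext.smul_eq_comp_mk₀, P.extMk_comp_mk₀]
  congr 1

/-- Here `r` acts through the first variable, by precomposition with `r • 𝟙 M`; bilinearity of the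
Yoneda product identifies this with the scalar action on `Ext`. -/
lemma injectiveResolution_extMk_smul {M N : ModuleCat.{u} R} (I : InjectiveResolution N)
    {n : ℕ} (r : R) (f : M ⟶ I.cocomplex.X n) (m : ℕ) (hm : n + 1 = m)
    (hf : f ≫ I.cocomplex.d n m = 0) :
    I.extMk (r • f) m hm (by rw [Linear.smul_comp, hf, smul_zero]) = r • I.extMk f m hm hf := by
  have h : I.extMk (r • f) m hm (by rw [Linear.smul_comp, hf, smul_zero]) =
      (Abelian.Ext.mk₀ (r • 𝟙 M)).comp (I.extMk f m hm hf) (zero_add _) := by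
    rw [I.mk₀_comp_extMk]
    congr 1
    simp
  rw [h, Abelian.Ext.mk₀_smul, Abelian.Ext.smul_comp, Abelian.Ext.mk₀_id_comp]

/-- `Abelian.Ext` is computed by any projective resolution, `R`-linearly. -/
theorem nonempty_projectiveResolution_homology_linearEquiv_ext {M : ModuleCat.{u} R}
    (P : ProjectiveResolution M) (N : ModuleCat.{u} R) (n : ℕ) :
    Nonempty ((P.complex.linearYonedaObj R N).homology n ≃ₗ[R] Abelian.Ext M N n) := by
  cases n with
  | zero =>
    let φ : (M ⟶ N) →ₗ[R] (P.complex.linearYonedaObj R N).X 0 :=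
      Linear.leftComp R N (P.π.f 0)
    obtain ⟨e⟩ := nonempty_homology_zero_linearEquiv (P.complex.linearYonedaObj R N) φ
      (fun f g h => (cancel_epi (P.π.f 0)).1 h) (fun f => by
        constructor
        · intro hf
          have := P.isColimitCokernelCofork
          exact ⟨this.desc (Limits.CokernelCofork.ofπ f hf),
            this.fac (Limits.CokernelCofork.ofπ f hf) Limits.WalkingParallelPair.one⟩
        · rintro ⟨g, rfl⟩
          exact (P.complex_d_comp_π_f_zero_assoc g).trans Limits.zero_comp)
    exact ⟨e ≪≫ₗ Abelian.Ext.linearEquiv₀.symm⟩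
  | succ n =>
    let φ : LinearMap.ker ((P.complex.linearYonedaObj R N).d (n + 1) (n + 2)).hom →ₗ[R]
        Abelian.Ext M N (n + 1) :=
      { toFun z := P.extMk (z.1 : P.complex.X (n + 1) ⟶ N) (n + 2) rfl z.2
        map_add' z w := (P.add_extMk _ _ (n + 2) rfl z.2 w.2).symm
        map_smul' r z := projectiveResolution_extMk_smul P r _ (n + 2) rfl z.2 }
    refine nonempty_homology_succ_linearEquiv _ n φ (fun x => ?_) (fun z => ?_)
    · obtain ⟨f, hf, rfl⟩ := P.extMk_surjective x (n + 2) rfl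
      exact ⟨⟨f, hf⟩, rfl⟩
    · exact P.extMk_eq_zero_iff _ (n + 2) rfl z.2 n rfl

/-- `Abelian.Ext` is computed by any injective resolution, `R`-linearly. -/
theorem nonempty_injectiveResolution_homology_linearEquiv_ext {N : ModuleCat.{u} R}
    (I : InjectiveResolution N) (M : ModuleCat.{u} R) (n : ℕ) :
    Nonempty (((((linearCoyoneda R (ModuleCat.{u} R)).obj (Opposite.op M)).mapHomologicalComplex
      (ComplexShape.up ℕ)).obj I.cocomplex).homology n ≃ₗ[R] Abelian.Ext M N n) := by
  cases n with
  | zero =>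
    let φ : (M ⟶ N) →ₗ[R] ((((linearCoyoneda R (ModuleCat.{u} R)).obj
        (Opposite.op M)).mapHomologicalComplex (ComplexShape.up ℕ)).obj I.cocomplex).X 0 :=
      Linear.rightComp R M (I.ι.f 0)
    obtain ⟨e⟩ := nonempty_homology_zero_linearEquiv _ φ
      (fun f g h => (cancel_mono (I.ι.f 0)).1 h) (fun f => by
        constructor
        · intro hf
          have := I.isLimitKernelFork
          exact ⟨this.lift (Limits.KernelFork.ofι f hf),
            this.fac (Limits.KernelFork.ofι f hf) Limits.WalkingParallelPair.zero⟩
        · rintro ⟨g, rfl⟩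
          exact (Category.assoc _ _ _).trans
            ((congrArg (g ≫ ·) I.ι_f_zero_comp_complex_d).trans Limits.comp_zero))
    exact ⟨e ≪≫ₗ Abelian.Ext.linearEquiv₀.symm⟩
  | succ n =>
    let φ : LinearMap.ker (((((linearCoyoneda R (ModuleCat.{u} R)).obj
        (Opposite.op M)).mapHomologicalComplex (ComplexShape.up ℕ)).obj I.cocomplex).d
          (n + 1) (n + 2)).hom →ₗ[R] Abelian.Ext M N (n + 1) :=
      { toFun z := I.extMk (z.1 : M ⟶ I.cocomplex.X (n + 1)) (n + 2) rfl z.2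
        map_add' z w := (I.add_extMk _ _ (n + 2) rfl z.2 w.2).symm
        map_smul' r z := injectiveResolution_extMk_smul I r _ (n + 2) rfl z.2 }
    refine nonempty_homology_succ_linearEquiv _ n φ (fun x => ?_) (fun z => ?_)
    · obtain ⟨f, hf, rfl⟩ := I.extMk_surjective x (n + 2) rfl
      exact ⟨⟨f, hf⟩, rfl⟩
    · exact I.extMk_eq_zero_iff _ (n + 2) rfl z.2 n rfl

end RelExt

/-! ### Relative Ext over an invertible module. -/

namespace RelExt

variable {R : Type u} [CommRing R]

/-- The conclusion is an equality of complexes, so that the homology of `Hom(L, N)` can be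
transported by rewriting. -/
lemma exists_projectiveResolution_of_exact {M : ModuleCat.{u} R}
    (L : ChainComplex (ModuleCat.{u} R) ℕ) (hL : ∀ n, Projective (L.X n)) (ε : L.X 0 ⟶ M)
    (hdε : L.d 1 0 ≫ ε = 0) (hε : Function.Surjective ε.hom)
    (h₀ : Function.Exact (L.d 1 0).hom ε.hom)
    (h : ∀ n, Function.Exact (L.d (n + 2) (n + 1)).hom (L.d (n + 1) n).hom) :
    ∃ P : ProjectiveResolution M, P.complex = L := by
  refine ⟨{ complex := L, projective := hL, quasiIso := ⟨fun n => ?_⟩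
            π := (ChainComplex.toSingle₀Equiv _ _).symm ⟨ε, hdε⟩ }, rfl⟩
  cases n with
  | zero =>
    rw [ChainComplex.quasiIsoAt₀_iff, ShortComplex.quasiIso_iff_of_zeros']
    · refine (ShortComplex.exact_and_epi_g_iff_of_iso
        (S₂ := ShortComplex.mk _ _ hdε) ?_).2
        ⟨(ShortComplex.ShortExact.moduleCat_exact_iff_function_exact _).2 h₀,
          (ModuleCat.epi_iff_surjective ε).2 hε⟩
      exact ShortComplex.isoMk (Iso.refl _) (Iso.refl _) (Iso.refl _)
        (by simp; exact (Category.id_comp _).trans (Category.comp_id _).symm)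
        (by simp; exact (Category.id_comp _).trans (Category.comp_id _).symm)
    all_goals first | rfl | exact L.shape 0 0 (by simp)
  | succ n =>
    rw [quasiIsoAt_iff_exactAt']
    · rw [HomologicalComplex.exactAt_iff' _ (n + 2) (n + 1) n (by simp) (by simp)]
      exact (ShortComplex.ShortExact.moduleCat_exact_iff_function_exact _).2 (h n)
    · apply ChainComplex.exactAt_succ_single_obj

lemma exists_injectiveResolution_of_exact {N : ModuleCat.{u} R}
    (J : CochainComplex (ModuleCat.{u} R) ℕ) (hJ : ∀ n, Injective (J.X n)) (η : N ⟶ J.X 0)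
    (hηd : η ≫ J.d 0 1 = 0) (hη : Function.Injective η.hom)
    (h₀ : Function.Exact η.hom (J.d 0 1).hom)
    (h : ∀ n, Function.Exact (J.d n (n + 1)).hom (J.d (n + 1) (n + 2)).hom) :
    ∃ I : InjectiveResolution N, I.cocomplex = J := by
  refine ⟨{ cocomplex := J, injective := hJ, quasiIso := ⟨fun n => ?_⟩
            ι := (CochainComplex.fromSingle₀Equiv _ _).symm ⟨η, hηd⟩ }, rfl⟩
  cases n with
  | zero =>
    rw [CochainComplex.quasiIsoAt₀_iff, ShortComplex.quasiIso_iff_of_zeros]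
    · refine (ShortComplex.exact_and_mono_f_iff_of_iso
        (S₂ := ShortComplex.mk _ _ hηd) ?_).2
        ⟨(ShortComplex.ShortExact.moduleCat_exact_iff_function_exact _).2 h₀,
          (ModuleCat.mono_iff_injective η).2 hη⟩
      exact ShortComplex.isoMk (Iso.refl _) (Iso.refl _) (Iso.refl _)
        (by simp; exact (Category.id_comp _).trans (Category.comp_id _).symm)
        (by simp; exact (Category.id_comp _).trans (Category.comp_id _).symm)
    all_goals first | rfl | exact J.shape 0 0 (by simp)
  | succ n =>
    rw [quasiIsoAt_iff_exactAt]
    · rw [HomologicalComplex.exactAt_iff' _ n (n + 1) (n + 2) (by simp) (by simp)]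
      exact (ShortComplex.ShortExact.moduleCat_exact_iff_function_exact _).2 (h n)
    · apply CochainComplex.exactAt_succ_single_obj

/-- Evaluation `C* ⊗ C → R` is onto, so `1 = ∑ φᵢ(cᵢ)` and `y = ∑ φᵢ(cᵢ) y`. This recovers elements
of `Y` from maps `C → Y` of the form `φ(-) y`. -/
lemma mem_of_forall_dual_smul_mem {C Y : Type*} [AddCommGroup C] [Module R C]
    [Module.Invertible R C] [AddCommGroup Y] [Module R Y] {S : Submodule R Y} {y : Y}
    (h : ∀ (φ : Module.Dual R C) (c : C), φ c • y ∈ S) : y ∈ S := by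
  obtain ⟨t, ht⟩ := (Module.Invertible.bijective (R := R) (M := C)).2 1
  rw [← one_smul R y, ← ht]
  clear ht
  induction t with
  | zero => simp
  | tmul φ c => exact h φ c
  | add s t hs ht => rw [map_add, add_smul]; exact S.add_mem hs ht

lemma surjective_of_surjective_homMap (C : ModuleCat.{u} R) [Module.Invertible R C]
    {X Y : ModuleCat.{u} R} {f : X ⟶ Y} (hf : Function.Surjective (homMap C f)) :
    Function.Surjective f.hom := fun y => by
  refine mem_of_forall_dual_smul_mem (C := C) (S := LinearMap.range f.hom) fun φ c => ?_
  obtain ⟨g, hg⟩ := hf (φ.smulRight y)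
  exact ⟨g c, LinearMap.congr_fun hg c⟩

lemma exact_of_exact_homMap (C : ModuleCat.{u} R) [Module.Invertible R C]
    {X Y Z : ModuleCat.{u} R} {f : X ⟶ Y} {g : Y ⟶ Z} (hfg : f ≫ g = 0)
    (h : Function.Exact (homMap C f) (homMap C g)) : Function.Exact f.hom g.hom := fun y => by
  constructor
  · intro hy
    refine mem_of_forall_dual_smul_mem (C := C) (S := LinearMap.range f.hom) fun φ c => ?_
    obtain ⟨k, hk⟩ := (h (φ.smulRight y)).1 (LinearMap.ext fun c => by simp [hy])
    exact ⟨k c, LinearMap.congr_fun hk c⟩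
  · rintro ⟨x, rfl⟩
    exact LinearMap.congr_fun (congrArg ModuleCat.Hom.hom hfg) x

lemma exact_of_exact_tensorMap (C : ModuleCat.{u} R) [Module.Invertible R C]
    {X Y Z : ModuleCat.{u} R} {f : X ⟶ Y} {g : Y ⟶ Z}
    (h : Function.Exact (tensorMap C f) (tensorMap C g)) : Function.Exact f.hom g.hom := by
  let e : Module.Dual R C ⊗[R] C ≃ₗ[R] R := Module.Invertible.linearEquiv R C
  have h' := Module.Flat.lTensor_exact (Module.Dual R C) h
  -- Naturality of `C* ⊗ (C ⊗ A) ≅ A`: tensoring once more with the flat module `C*` undoes `C ⊗ -`.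
  have key : ∀ {A B : ModuleCat.{u} R} (k : A ⟶ B),
      k.hom ∘ₗ (Module.Invertible.leftCancelEquiv A e).toLinearMap =
        (Module.Invertible.leftCancelEquiv B e).toLinearMap ∘ₗ
          LinearMap.lTensor (Module.Dual R C) (tensorMap C k) := fun k =>
    TensorProduct.ext' fun φ t => by
      induction t with
      | zero => simp
      | add s t hs ht => simp only [TensorProduct.tmul_add, map_add, hs, ht]
      | tmul c a => simp [Module.Invertible.leftCancelEquiv]
  exact (Function.Exact.iff_of_ladder_linearEquiv (key f) (key g)).2 h'

/-- `Hom(C, -)` is right adjoint to the exact functor `- ⊗ C`. -/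
lemma module_injective_linearMap (C I : Type u) [AddCommGroup C] [Module R C] [AddCommGroup I]
    [Module R I] [Module.Flat R C] [Module.Injective R I] : Module.Injective R (C →ₗ[R] I) := by
  refine ⟨fun X Y _ _ _ _ f hf g => ?_⟩
  obtain ⟨k, hk⟩ := Module.Injective.out (R := R) (Q := I) (f.rTensor C)
    (Module.Flat.rTensor_preserves_injective_linearMap f hf) (TensorProduct.lift g)
  exact ⟨TensorProduct.curry k, fun x => LinearMap.ext fun c => hk (x ⊗ₜ c)⟩

theorem nonempty_extPC_linearEquiv_ext (C : ModuleCat.{u} R) [Module.Invertible R C]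
    (M N : ModuleCat.{u} R) (n : ℕ) : Nonempty (ExtPC C M N n ≃ₗ[R] Abelian.Ext M N n) := by
  let L := properProjResolution C M
  obtain ⟨P, hP⟩ := exists_projectiveResolution_of_exact L.complex
    (fun n => by
      obtain ⟨Q, hQ, ⟨e⟩⟩ := L.isCProjective n
      exact (IsProjective.iff_projective _).1 (Module.Projective.of_equiv e.symm))
    L.augmentation L.d_comp_augmentation (surjective_of_surjective_homMap C L.surjective)
    (exact_of_exact_homMap C L.d_comp_augmentation L.exact_zero)
    (fun n => exact_of_exact_homMap C (L.complex.d_comp_d _ _ _) (L.exact_succ n))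
  have := nonempty_projectiveResolution_homology_linearEquiv_ext P N n
  rw [hP] at this
  exact this

theorem nonempty_extIC_linearEquiv_ext (C : ModuleCat.{u} R) [Module.Invertible R C]
    (M N : ModuleCat.{u} R) (n : ℕ) : Nonempty (ExtIC C M N n ≃ₗ[R] Abelian.Ext M N n) := by
  let J := properInjResolution C N
  obtain ⟨I, hI⟩ := exists_injectiveResolution_of_exact J.cocomplex
    (fun n => by
      obtain ⟨Q, hQ, ⟨e⟩⟩ := J.isCInjective n
      have := (Module.injective_iff_injective_object R (C →ₗ[R] Q)).1
        (module_injective_linearMap C Q)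
      exact Injective.of_iso e.symm.toModuleIso this)
    J.coaugmentation J.coaugmentation_comp_d
    ((Module.Invertible.lTensor_injective_iff C).1 J.injective)
    (exact_of_exact_tensorMap C J.exact_zero)
    (fun n => exact_of_exact_tensorMap C (J.exact_succ n))
  have := nonempty_injectiveResolution_homology_linearEquiv_ext I M n
  rw [hI] at this
  exact this

end RelExt

/-! ### `Ext_{P_C}(C, -)` in degrees zero and one. -/

namespace RelExt

variable {R : Type u} [CommRing R]

/-- `C`-projective modules have the lifting property against `Hom_R(C, -)`-exact sequences. -/
lemma IsCProjective.exists_lift {C X : ModuleCat.{u} R} (hX : IsCProjective C X)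
    {A B D : ModuleCat.{u} R} {f : A ⟶ B} {g : B ⟶ D}
    (hfg : Function.Exact (homMap C f) (homMap C g)) (k : X ⟶ B) (hk : k ≫ g = 0) :
    ∃ l : X ⟶ A, l ≫ f = k := by
  obtain ⟨P, hP, ⟨e⟩⟩ := hX
  -- By adjunction `k` is a map from `P` to the kernel of `Hom(C, g)`; `Hom(C, f)` covers that
  -- kernel, so projectivity of `P` gives the lift.
  let κ : P →ₗ[R] LinearMap.ker (homMap C g) :=
    (TensorProduct.curry (k.hom ∘ₗ e.symm.toLinearMap)).flip.codRestrict _ fun p =>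
      LinearMap.ext fun c => LinearMap.congr_fun (congrArg ModuleCat.Hom.hom hk) (e.symm (c ⊗ₜ p))
  let φ : (C →ₗ[R] A) →ₗ[R] LinearMap.ker (homMap C g) :=
    (homMap C f).codRestrict _ fun a => (hfg _).2 ⟨a, rfl⟩
  have hφ : Function.Surjective φ := fun b => by
    obtain ⟨a, ha⟩ := (hfg b.1).1 b.2
    exact ⟨a, Subtype.ext ha⟩
  obtain ⟨l, hl⟩ := Module.projective_lifting_property φ κ hφ
  refine ⟨ModuleCat.ofHom (TensorProduct.lift l.flip ∘ₗ e.toLinearMap), ?_⟩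
  have h : f.hom ∘ₗ TensorProduct.lift l.flip = k.hom ∘ₗ e.symm.toLinearMap :=
    TensorProduct.ext' fun c p =>
      LinearMap.congr_fun (congrArg Subtype.val (LinearMap.congr_fun hl p)) c
  ext x
  simpa using LinearMap.congr_fun h (e x)

section

variable {C : ModuleCat.{u} R} (L : ProperProjResolution C C)

/-- A proper resolution of `C` itself is contractible. -/
lemma ProperProjResolution.exists_contraction_zero :
    ∃ (s : C ⟶ L.complex.X 0) (h : L.complex.X 0 ⟶ L.complex.X 1),
      s ≫ L.augmentation = 𝟙 C ∧ h ≫ L.complex.d 1 0 = 𝟙 _ - L.augmentation ≫ s := by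
  obtain ⟨s, hs⟩ := L.surjective LinearMap.id
  have hs' : ModuleCat.ofHom s ≫ L.augmentation = 𝟙 C := ModuleCat.hom_ext hs
  obtain ⟨h, hh⟩ := (L.isCProjective 0).exists_lift L.exact_zero
    (𝟙 _ - L.augmentation ≫ ModuleCat.ofHom s) (by simp [hs'])
  exact ⟨_, h, hs', hh⟩

/-- The relation for `h` shows that `𝟙 - d ≫ h` is killed by the next differential `d`, so it lifts.
This one further homotopy suffices for degree one cohomology. -/
lemma ProperProjResolution.exists_contraction_one {s : C ⟶ L.complex.X 0}
    {h : L.complex.X 0 ⟶ L.complex.X 1}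
    (hh : h ≫ L.complex.d 1 0 = 𝟙 _ - L.augmentation ≫ s) :
    ∃ h' : L.complex.X 1 ⟶ L.complex.X 2,
      h' ≫ L.complex.d 2 1 = 𝟙 _ - L.complex.d 1 0 ≫ h :=
  (L.isCProjective 1).exists_lift (L.exact_succ 0) _ (by
    rw [Preadditive.sub_comp, Category.assoc, hh, Preadditive.comp_sub,
      reassoc_of% L.d_comp_augmentation]
    simp)

end

theorem nonempty_extPC_zero_linearEquiv_hom (C N : ModuleCat.{u} R) :
    Nonempty (ExtPC C C N 0 ≃ₗ[R] (C →ₗ[R] N)) := by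
  let L := properProjResolution C C
  obtain ⟨s, h, hs, hh⟩ := L.exists_contraction_zero
  let φ : (C ⟶ N) →ₗ[R] (L.complex.linearYonedaObj R N).X 0 := Linear.leftComp R N L.augmentation
  obtain ⟨e⟩ := nonempty_homology_zero_linearEquiv (L.complex.linearYonedaObj R N) φ
    (fun f g hfg => by
      have : s ≫ L.augmentation ≫ f = s ≫ L.augmentation ≫ g := congrArg (s ≫ ·) hfg
      rwa [reassoc_of% hs, reassoc_of% hs] at this)
    (fun (f : L.complex.X 0 ⟶ N) => by
      constructor
      · intro (hf : L.complex.d 1 0 ≫ f = 0)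
        refine ⟨s ≫ f, show L.augmentation ≫ s ≫ f = f from ?_⟩
        have : (h ≫ L.complex.d 1 0) ≫ f = 0 := by rw [Category.assoc, hf, Limits.comp_zero]
        rw [hh, Preadditive.sub_comp, Category.id_comp, sub_eq_zero] at this
        rw [← Category.assoc, ← this]
      · rintro ⟨g, rfl⟩
        show L.complex.d 1 0 ≫ L.augmentation ≫ g = 0
        rw [reassoc_of% L.d_comp_augmentation, Limits.zero_comp])
  exact ⟨e ≪≫ₗ ModuleCat.homLinearEquiv⟩

theorem subsingleton_extPC_one (C N : ModuleCat.{u} R) : Subsingleton (ExtPC C C N 1) := by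
  let L := properProjResolution C C
  obtain ⟨s, h, hs, hh⟩ := L.exists_contraction_zero
  obtain ⟨h', hh'⟩ := L.exists_contraction_one hh
  have key (f : L.complex.X 1 ⟶ N) (hf : L.complex.d 2 1 ≫ f = 0) :
      L.complex.d 1 0 ≫ h ≫ f = f := by
    have : (h' ≫ L.complex.d 2 1) ≫ f = 0 := by rw [Category.assoc, hf, Limits.comp_zero]
    rw [hh', Preadditive.sub_comp, Category.id_comp, sub_eq_zero, Category.assoc] at this
    exact this.symm
  obtain ⟨e⟩ := nonempty_homology_succ_linearEquiv (E := PUnit) (L.complex.linearYonedaObj R N) 0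
    0 (fun _ => ⟨0, rfl⟩)
    (fun z => ⟨fun _ => ⟨h ≫ (z.1 : L.complex.X 1 ⟶ N), key z.1 z.2⟩, fun _ => rfl⟩)
  exact e.toEquiv.subsingleton

end RelExt

/-! ### Tensor evaluation and `Ext⁰_{I_C}(M, N) ≅ Hom(C ⊗ M, C ⊗ N)`. -/

namespace RelExt

variable {R : Type u} [CommRing R]

lemma exists_comp_eq_of_ker_le {Y Z I : Type u} [AddCommGroup Y] [Module R Y] [AddCommGroup Z]
    [Module R Z] [AddCommGroup I] [Module R I] [Module.Injective R I] (g : Y →ₗ[R] Z)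
    (k : Y →ₗ[R] I) (h : LinearMap.ker g ≤ LinearMap.ker k) : ∃ l : Z →ₗ[R] I, l ∘ₗ g = k := by
  obtain ⟨l, hl⟩ := Module.Injective.out (R := R) (Q := I) ((LinearMap.ker g).liftQ g le_rfl)
    (LinearMap.ker_eq_bot.1 (Submodule.ker_liftQ_eq_bot _ _ _ le_rfl))
    ((LinearMap.ker g).liftQ k h)
  exact ⟨l, LinearMap.ext fun y => hl (Submodule.Quotient.mk y)⟩

/-- The tensor evaluation map `A ⊗ Hom(B, I) → Hom(Hom(A, B), I)`. -/
def tensorEval (R : Type u) [CommRing R] (A B I : Type*) [AddCommGroup A] [Module R A]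
    [AddCommGroup B] [Module R B] [AddCommGroup I] [Module R I] :
    A ⊗[R] (B →ₗ[R] I) →ₗ[R] (A →ₗ[R] B) →ₗ[R] I :=
  TensorProduct.lift (LinearMap.mk₂ R (fun a f => f ∘ₗ LinearMap.applyₗ a)
    (fun a a' f => by ext; simp) (fun r a f => by ext; simp)
    (fun a f f' => by ext; simp) (fun r a f => by ext; simp))

section

variable {A A' B I : Type*} [AddCommGroup A] [Module R A] [AddCommGroup A'] [Module R A']
  [AddCommGroup B] [Module R B] [AddCommGroup I] [Module R I]

@[simp]
lemma tensorEval_tmul (a : A) (f : B →ₗ[R] I) (g : A →ₗ[R] B) :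
    tensorEval R A B I (a ⊗ₜ f) g = f (g a) := rfl

lemma tensorEval_rTensor (p : A →ₗ[R] A') (t : A ⊗[R] (B →ₗ[R] I)) :
    tensorEval R A' B I (p.rTensor _ t) = tensorEval R A B I t ∘ₗ LinearMap.lcomp R B p := by
  induction t with
  | zero => simp
  | tmul a f => rfl
  | add s t hs ht => simp only [map_add, hs, ht, LinearMap.add_comp]

/-- The inverse is `h ↦ ∑ eᵢ ⊗ (h ∘ jᵢ)`, where `jᵢ b` is the map `a ↦ aᵢ b`. -/
lemma tensorEval_bijective_of_pi (n : ℕ) :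
    Function.Bijective (tensorEval R (Fin n → R) B I) := by
  let j (i : Fin n) : B →ₗ[R] (Fin n → R) →ₗ[R] B :=
    LinearMap.smulRightₗ (LinearMap.proj i)
  let ψ : (((Fin n → R) →ₗ[R] B) →ₗ[R] I) → (Fin n → R) ⊗[R] (B →ₗ[R] I) := fun h =>
    ∑ i, Pi.single i 1 ⊗ₜ (h ∘ₗ j i)
  refine Function.bijective_iff_has_inverse.2 ⟨ψ, fun t => ?_, fun h => LinearMap.ext fun g => ?_⟩
  · induction t with
    | zero => simp [ψ]
    | add s t hs ht =>
      conv_rhs => rw [← hs, ← ht]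
      simp only [ψ, map_add, LinearMap.add_comp, TensorProduct.tmul_add, Finset.sum_add_distrib]
    | tmul a f =>
      have h (i : Fin n) : tensorEval R (Fin n → R) B I (a ⊗ₜ f) ∘ₗ j i = a i • f := by
        ext b
        simp [j]
      simp only [ψ, h, ← TensorProduct.smul_tmul]
      rw [← TensorProduct.sum_tmul]
      congr 1
      simpa using (pi_eq_sum_univ' a).symm
  · simp only [ψ, map_sum, LinearMap.sum_apply, tensorEval_tmul, LinearMap.comp_apply]
    rw [← map_sum]
    congr 1
    refine (Pi.basisFun R (Fin n)).ext fun k => ?_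
    simp [j, LinearMap.sum_apply, Pi.single_apply]

end

/-- Both sides are right exact in `A`, since `Hom(-, I)` is exact. The free case is carried along a
presentation `R^m → R^n → A → 0`, which exists by noetherianity. -/
lemma tensorEval_bijective [IsNoetherianRing R] (A B I : Type u) [AddCommGroup A] [Module R A]
    [Module.Finite R A] [AddCommGroup B] [Module R B] [AddCommGroup I] [Module R I]
    [Module.Injective R I] : Function.Bijective (tensorEval R A B I) := by
  obtain ⟨n, p, hp⟩ := Module.Finite.exists_fin' R A
  obtain ⟨m, q', hq'⟩ := Module.Finite.exists_fin' R (LinearMap.ker p)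
  let q := (LinearMap.ker p).subtype ∘ₗ q'
  have hq : ∀ x, p x = 0 → ∃ y, q y = x := fun x hx => by
    obtain ⟨y, hy⟩ := hq' ⟨x, hx⟩
    exact ⟨y, congrArg Subtype.val hy⟩
  have hpq : p ∘ₗ q = 0 := LinearMap.ext fun y => (q' y).2
  constructor
  · rw [injective_iff_map_eq_zero]
    intro t ht
    obtain ⟨t, rfl⟩ := LinearMap.rTensor_surjective _ hp t
    rw [tensorEval_rTensor] at ht
    -- The functional of `t` vanishes on maps factoring through `p`, that is, on those killed by
    -- `q`; hence it extends along `Hom(q, B)`, and `t` comes from `R^m ⊗ Hom(B, I)`.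
    obtain ⟨h, hh⟩ := exists_comp_eq_of_ker_le (LinearMap.lcomp R B q)
      (tensorEval R (Fin n → R) B I t) (fun g hg => by
        have hle : LinearMap.ker p ≤ LinearMap.ker g := fun x hx => by
          obtain ⟨y, rfl⟩ := hq x hx
          exact LinearMap.congr_fun hg y
        obtain ⟨g', hg'⟩ : ∃ g' : A →ₗ[R] B, g' ∘ₗ p = g :=
          ⟨(LinearMap.ker p).liftQ g hle ∘ₗ (p.quotKerEquivOfSurjective hp).symm.toLinearMap,
            LinearMap.ext fun x => by
              have : (p.quotKerEquivOfSurjective hp).symm (p x) = Submodule.Quotient.mk x :=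
                (LinearEquiv.symm_apply_eq _).2 rfl
              simp [this]⟩
        rw [← hg']
        exact LinearMap.congr_fun ht g')
    obtain ⟨s, rfl⟩ := (tensorEval_bijective_of_pi m).2 h
    rw [← tensorEval_rTensor] at hh
    rw [← (tensorEval_bijective_of_pi n).1 hh, ← LinearMap.comp_apply, ← LinearMap.rTensor_comp,
      hpq, LinearMap.rTensor_zero, LinearMap.zero_apply]
  · intro h
    obtain ⟨h', rfl⟩ := exists_comp_eq_of_ker_le (LinearMap.lcomp R B p) h (fun g hg => by
      have : g = 0 := LinearMap.ext fun a => by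
        obtain ⟨x, rfl⟩ := hp a
        exact LinearMap.congr_fun hg x
      rw [this]
      exact zero_mem _)
    obtain ⟨t, rfl⟩ := (tensorEval_bijective_of_pi n).2 h'
    exact ⟨p.rTensor _ t, tensorEval_rTensor p t⟩

variable [IsNoetherianRing R] {C : ModuleCat.{u} R}

/-- Evaluation `C ⊗ Hom(C, I) → I` is tensor evaluation into `Hom(Hom(C, C), I)` followed by
evaluation at `id`, and `Hom(C, C) = R`. -/
lemma IsSemidualizing.lift_id_flip_bijective (hC : IsSemidualizing C) (I : Type u)
    [AddCommGroup I] [Module R I] [Module.Injective R I] :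
    Function.Bijective (TensorProduct.lift (LinearMap.id (M := C →ₗ[R] I)).flip) := by
  have := hC.finite
  have h₁ : TensorProduct.lift (LinearMap.id (M := C →ₗ[R] I)).flip =
      LinearMap.applyₗ LinearMap.id ∘ₗ tensorEval R C C I := TensorProduct.ext' fun _ _ => rfl
  rw [h₁, LinearMap.coe_comp]
  refine Function.Bijective.comp ⟨?_, fun x => ?_⟩ (tensorEval_bijective C C I)
  · rw [injective_iff_map_eq_zero]
    intro h hh
    ext g
    obtain ⟨r, rfl⟩ := hC.homothety_bijective.2 g
    have : LinearMap.lsmul R C r = r • LinearMap.id := rfl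
    rw [this, map_smul]
    exact (congrArg (r • ·) hh).trans (smul_zero r)
  · let e := LinearEquiv.ofBijective _ hC.homothety_bijective
    refine ⟨LinearMap.toSpanSingleton R I x ∘ₗ e.symm.toLinearMap, ?_⟩
    have : e.symm LinearMap.id = 1 :=
      (LinearEquiv.symm_apply_eq _).2 (LinearMap.ext fun c => (one_smul R c).symm)
    simp [this]

/-- For `Y = Hom(C, I)`, adjunction gives `Hom(M, Y) = Hom(C ⊗ M, I)`, and `I ≅ C ⊗ Y` by
evaluation. -/
lemma IsSemidualizing.lTensorHom_bijective (hC : IsSemidualizing C) {Y : ModuleCat.{u} R}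
    (hY : IsCInjective C Y) (M : Type u) [AddCommGroup M] [Module R M] :
    Function.Bijective (LinearMap.lTensorHom C : (M →ₗ[R] Y) →ₗ[R] C ⊗[R] M →ₗ[R] C ⊗[R] Y) := by
  obtain ⟨I, hI, ⟨e⟩⟩ := hY
  let w : C ⊗[R] Y ≃ₗ[R] I := e.lTensor C ≪≫ₗ
    LinearEquiv.ofBijective _ (hC.lift_id_flip_bijective I)
  have hw (c : C) (y : Y) : w (c ⊗ₜ y) = e y c := rfl
  constructor
  · intro f f' h
    ext m
    apply e.injective
    ext c
    rw [← hw, ← hw]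
    exact congrArg w (LinearMap.congr_fun h (c ⊗ₜ m))
  · intro g
    refine ⟨e.symm.toLinearMap ∘ₗ (TensorProduct.curry (w.toLinearMap ∘ₗ g)).flip,
      TensorProduct.ext' fun c m => w.injective ?_⟩
    simp [hw]

/-- Under `lTensorHom`, degree zero cocycles become maps from `C ⊗ M` into the kernel of `C ⊗ J⁰ → C
⊗ J¹`, which is `C ⊗ N` by properness. -/
theorem IsSemidualizing.nonempty_extIC_zero_linearEquiv_hom (hC : IsSemidualizing C)
    (M N : ModuleCat.{u} R) : Nonempty (ExtIC C M N 0 ≃ₗ[R] (C ⊗[R] M →ₗ[R] C ⊗[R] N)) := by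
  let J := properInjResolution C N
  let E := LinearEquiv.ofBijective _ (hC.lTensorHom_bijective (J.isCInjective 0) M)
  let φ : (C ⊗[R] M →ₗ[R] C ⊗[R] N) →ₗ[R] (M ⟶ J.cocomplex.X 0) :=
    ModuleCat.homLinearEquiv.symm.toLinearMap ∘ₗ E.symm.toLinearMap ∘ₗ
      LinearMap.compRight R (tensorMap C J.coaugmentation)
  have hφ (g : C ⊗[R] M →ₗ[R] C ⊗[R] N) (f : M ⟶ J.cocomplex.X 0) :
      φ g = f ↔ tensorMap C J.coaugmentation ∘ₗ g = tensorMap C f := by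
    refine (LinearEquiv.symm_apply_eq _).trans ((LinearEquiv.symm_apply_eq _).trans Iff.rfl)
  have hφ' (g : C ⊗[R] M →ₗ[R] C ⊗[R] N) := (hφ g (φ g)).1 rfl
  refine nonempty_homology_zero_linearEquiv _ φ (fun g g' h => ?_) (fun f => ?_)
  · have h' := (hφ' g).trans ((congrArg (tensorMap C) h).trans (hφ' g').symm)
    exact LinearMap.ext fun x => J.injective (LinearMap.congr_fun h' x)
  · have hf : f ≫ J.cocomplex.d 0 1 = 0 ↔
        tensorMap C (J.cocomplex.d 0 1) ∘ₗ tensorMap C f = 0 := by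
      rw [← LinearMap.lTensor_comp]
      refine Iff.trans ?_ (map_eq_zero_iff _ (hC.lTensorHom_bijective (J.isCInjective 1) M).1).symm
      exact ModuleCat.hom_ext_iff
    refine hf.trans ⟨fun h => ?_, ?_⟩
    · have hr (x : C ⊗[R] M) : ∃ y, tensorMap C J.coaugmentation y = tensorMap C f x :=
        (J.exact_zero _).1 (LinearMap.congr_fun h x)
      let i := LinearEquiv.ofInjective _ J.injective
      refine ⟨i.symm.toLinearMap ∘ₗ (tensorMap C f).codRestrict _ hr, (hφ _ _).2 ?_⟩
      exact LinearMap.ext fun x => congrArg Subtype.val (i.apply_symm_apply ⟨_, hr x⟩)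
    · rintro ⟨g, rfl⟩
      refine (congrArg (tensorMap C (J.cocomplex.d 0 1) ∘ₗ ·) (hφ' g)).symm.trans ?_
      change tensorMap C (J.cocomplex.d 0 1) ∘ₗ tensorMap C J.coaugmentation ∘ₗ g = 0
      rw [← LinearMap.comp_assoc, J.exact_zero.linearMap_comp_eq_zero,
        LinearMap.zero_comp]

end RelExt

/-! ### Criteria for projectivity near a maximal ideal. -/

namespace RelExt

variable {R : Type u} [CommRing R]

section Projectivity

variable {C F Z : Type*} [AddCommGroup C] [Module R C] [AddCommGroup F] [Module R F]
  [AddCommGroup Z] [Module R Z]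

/-- The scalars `s` with `s • id` in the image form an ideal. Lying in no maximal ideal, it contains
`1`, which is the dual basis criterion. -/
lemma projective_of_forall_maximal_exists_smul_id_mem_range
    (h : ∀ m : Ideal R, m.IsMaximal → ∃ s ∉ m,
      s • LinearMap.id ∈ LinearMap.range (dualTensorHom R C C)) : Module.Projective R C := by
  let J : Ideal R := (LinearMap.range (dualTensorHom R C C)).comap (LinearMap.lsmul R C)
  have hJ : J = ⊤ := by
    by_contra hJ
    obtain ⟨m, hm, hJm⟩ := Ideal.exists_le_maximal J hJ
    obtain ⟨s, hs, hs'⟩ := h m hm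
    exact hs (hJm hs')
  have h1 : (1 : R) ∈ J := hJ ▸ Submodule.mem_top
  refine Module.Projective.of_one_mem_range_dualTensorHom ?_
  convert Submodule.mem_comap.1 h1
  ext c
  simp

/-- The map is `x ↦ k (g⁻¹ (r x))`, well defined by `hk`: a denominator-free descent of `k` along a
`g` that is onto after inverting `r`. -/
lemma exists_linearMap_of_smul_mem_range (g : F →ₗ[R] C) (k : F →ₗ[R] Z)
    (hk : LinearMap.ker g ≤ LinearMap.ker k) (r : R) (hr : ∀ x, r • x ∈ LinearMap.range g) :
    ∃ φ : C →ₗ[R] Z, ∀ x a, g a = r • x → φ x = k a := by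
  let l : LinearMap.range g →ₗ[R] Z :=
    (LinearMap.ker g).liftQ k hk ∘ₗ g.quotKerEquivRange.symm.toLinearMap
  have hl (a : F) : l ⟨g a, a, rfl⟩ = k a := by
    have : g.quotKerEquivRange.symm ⟨g a, a, rfl⟩ = Submodule.Quotient.mk a :=
      (LinearEquiv.symm_apply_eq _).2 rfl
    simp [l, this]
  refine ⟨l ∘ₗ (r • LinearMap.id : C →ₗ[R] C).codRestrict _ hr, fun x a ha => ?_⟩
  rw [← hl, LinearMap.comp_apply]
  exact congrArg l (Subtype.ext ha.symm)

/-- A finite faithful module whose fibre at a maximal ideal `m` is cyclic is projective near `m`. -/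
lemma exists_smul_id_mem_range_of_cyclic_mod [Module.Finite R C] [FaithfulSMul R C] {m : Ideal R}
    (hm : m.IsMaximal) (c : C) (hc : ∀ x : C, ∃ a : R, x - a • c ∈ m • (⊤ : Submodule R C)) :
    ∃ s ∉ m, s • LinearMap.id ∈ LinearMap.range (dualTensorHom R C C) := by
  -- Nakayama: some `r ≡ 1` mod `m` satisfies `r C ⊆ R c`.
  obtain ⟨r, hrm, hr⟩ := Submodule.exists_sub_one_mem_and_smul_le_of_fg_of_le_sup (I := m)
    (N := R ∙ c) (N' := ⊤) (P := ⊤) Module.Finite.fg_top le_rfl fun x _ => by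
      obtain ⟨a, ha⟩ := hc x
      rw [← add_sub_cancel (a • c) x]
      exact Submodule.add_mem_sup (Submodule.smul_mem _ _ (Submodule.mem_span_singleton_self c)) ha
  have hr' (x : C) : ∃ a : R, a • c = r • x :=
    Submodule.mem_span_singleton.1 (hr (Submodule.smul_mem_pointwise_smul x r ⊤ trivial))
  -- If `a c = 0` then `r a` kills `C`, so `r a = 0` by faithfulness. Hence `φ x = r a` for `a c = r
  -- x` is well defined, and `φ(x) c = r² x`.
  obtain ⟨φ, hφ⟩ := exists_linearMap_of_smul_mem_range (LinearMap.toSpanSingleton R C c)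
    (r • LinearMap.id : R →ₗ[R] R) (fun a (ha : a • c = 0) => by
      refine FaithfulSMul.eq_of_smul_eq_smul (α := C) fun x => ?_
      obtain ⟨b, hb⟩ := hr' x
      simp [mul_comm r a, mul_smul, ← hb, smul_comm a b c, ha]) r hr'
  refine ⟨r * r, fun h => ?_, φ ⊗ₜ c, LinearMap.ext fun x => ?_⟩
  · have hr1 : r ∈ m := (hm.isPrime.mem_or_mem h).elim id id
    exact hm.ne_top ((Ideal.eq_top_iff_one m).2 (by simpa using m.sub_mem hr1 hrm))
  · obtain ⟨a, ha⟩ := hr' x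
    rw [dualTensorHom_apply, hφ x a ha]
    simp [mul_smul, ha]

end Projectivity

section Length

/-- Maps into a finite power, componentwise. -/
def homPiEquiv (M N ι : Type*) [AddCommGroup M] [Module R M] [AddCommGroup N] [Module R N] :
    (M →ₗ[R] (ι → N)) ≃ₗ[R] (ι → M →ₗ[R] N) where
  toFun f i := LinearMap.proj i ∘ₗ f
  invFun f := LinearMap.pi f
  map_add' _ _ := rfl
  map_smul' _ _ := rfl
  left_inv _ := rfl
  right_inv _ := rfl

/-- With `n = dim (C/mC)`, the two sides have lengths `n` and `n³`, so `n ≤ 1`. Length over `R` is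
used because `e` is only `R`-linear. -/
lemma exists_forall_sub_smul_mem_of_linearEquiv {C : Type*} [AddCommGroup C] [Module R C]
    [Module.Finite R C] {m : Ideal R} (hm : m.IsMaximal)
    (e : (C →ₗ[R] R ⧸ m) ≃ₗ[R] (C ⊗[R] C →ₗ[R] C ⊗[R] (R ⧸ m))) :
    ∃ c : C, ∀ x : C, ∃ a : R, x - a • c ∈ m • (⊤ : Submodule R C) := by
  let := Ideal.Quotient.field m
  let k := R ⧸ m
  let b := Module.finBasis k (k ⊗[R] C)
  let n := Module.finrank k (k ⊗[R] C)
  let e₁ : (k ⊗[R] C) ≃ₗ[R] (Fin n → k) := b.equivFun.restrictScalars R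
  let e₂ : (C →ₗ[R] k) ≃ₗ[R] (Fin n → k) :=
    ((LinearMap.liftBaseChangeEquiv k).restrictScalars R) ≪≫ₗ
      (b.constr k).symm.restrictScalars R
  let e₃ : (C ⊗[R] C →ₗ[R] C ⊗[R] k) ≃ₗ[R] (Fin n → Fin n → Fin n → k) :=
    (TensorProduct.comm R C k ≪≫ₗ e₁).congrRight ≪≫ₗ homPiEquiv _ _ _ ≪≫ₗ
      LinearEquiv.piCongrRight fun _ =>
        (TensorProduct.lift.equiv (.id R) C C k).symm ≪≫ₗ e₂.congrRight ≪≫ₗ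
          homPiEquiv _ _ _ ≪≫ₗ LinearEquiv.piCongrRight fun _ => e₂
  have hk : Module.length R k = 1 := by
    have : IsSimpleModule R k := isSimpleModule_iff_quot_maximal.2 ⟨m, hm, ⟨.refl R _⟩⟩
    exact Module.length_eq_one R k
  have hn := (e₂.symm ≪≫ₗ e ≪≫ₗ e₃).length_eq
  simp only [Module.length_pi, hk, mul_one, ENat.card_eq_coe_fintype_card, Fintype.card_fin] at hn
  have hn' : n = n * (n * n) := by exact_mod_cast hn
  have hn1 : n ≤ 1 := by
    by_contra! h
    nlinarith
  let e₄ : (C ⧸ m • (⊤ : Submodule R C)) ≃ₗ[R] (Fin n → k) :=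
    (TensorProduct.quotTensorEquivQuotSMul C m).symm ≪≫ₗ e₁
  -- The constant vector `1` generates `k^n` both for `n = 0` and for `n = 1`.
  obtain ⟨c, hc⟩ := Submodule.mkQ_surjective _ (e₄.symm fun _ => 1)
  refine ⟨c, fun x => ?_⟩
  have hfin : Subsingleton (Fin n) := Fin.subsingleton_iff_le_one.2 hn1
  have : ∃ a : R, e₄ (Submodule.Quotient.mk x) = a • fun _ => (1 : k) := by
    obtain hn0 | hn0 := isEmpty_or_nonempty (Fin n)
    · exact ⟨0, Subsingleton.elim _ _⟩
    · obtain ⟨i⟩ := hn0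
      obtain ⟨a, ha⟩ := Ideal.Quotient.mk_surjective (e₄ (Submodule.Quotient.mk x) i)
      refine ⟨a, funext fun j => ?_⟩
      rw [Subsingleton.elim j i, ← ha, Pi.smul_apply, Algebra.smul_def, mul_one]
      rfl
  obtain ⟨a, ha⟩ := this
  refine ⟨a, (Submodule.Quotient.mk_eq_zero _).1 (e₄.injective ?_)⟩
  rw [Submodule.Quotient.mk_sub, Submodule.Quotient.mk_smul, map_sub, map_smul, ha]
  have : e₄ (Submodule.Quotient.mk c) = fun _ => 1 := by
    rw [← Submodule.mkQ_apply, hc, LinearEquiv.apply_symm_apply]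
  rw [this, sub_self, map_zero]

end Length

section Ext

lemma exists_comp_eq_of_subsingleton_ext {M N : ModuleCat.{u} R} [Subsingleton (Abelian.Ext M N 1)]
    {F : Type u} [AddCommGroup F] [Module R F] (p : F →ₗ[R] M) (hp : Function.Surjective p)
    (f : LinearMap.ker p →ₗ[R] N) : ∃ g : F →ₗ[R] N, g ∘ₗ (LinearMap.ker p).subtype = f := by
  let S : ShortComplex (ModuleCat.{u} R) := ShortComplex.mk
    (ModuleCat.ofHom (LinearMap.ker p).subtype) (ModuleCat.ofHom p) (by ext x; exact x.2)
  have hS : S.ShortExact :=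
    { exact := (ShortComplex.ShortExact.moduleCat_exact_iff_function_exact S).2
        (LinearMap.exact_subtype_ker_map p)
      mono_f := (ModuleCat.mono_iff_injective _).2 (LinearMap.ker p).injective_subtype
      epi_g := (ModuleCat.epi_iff_surjective _).2 hp }
  obtain ⟨x, hx⟩ := Abelian.Ext.contravariant_sequence_exact₁ hS N
    (Abelian.Ext.mk₀ (ModuleCat.ofHom f)) (n₁ := 1) rfl
    (Subsingleton.elim (α := Abelian.Ext M N 1) _ _)
  obtain ⟨g, rfl⟩ := (Abelian.Ext.mk₀_bijective _ _).2 x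
  rw [Abelian.Ext.mk₀_comp_mk₀] at hx
  exact ⟨g.hom, congrArg ModuleCat.Hom.hom ((Abelian.Ext.mk₀_bijective _ _).1 hx)⟩

/-- Cayley–Hamilton gives a monic `p` with lower coefficients in `m` and `p(u - 1) = 0`. Then `q(X)
= p(X - 1)` kills `u`, with `q(0) = p(-1) ≡ ±1` mod `m`; splitting off the constant term makes `u`
invertible up to `s = -q(0)`. -/
lemma exists_aeval_mul_eq_of_range_sub_one_le {K : Type*} [AddCommGroup K] [Module R K]
    [Module.Finite R K] {m : Ideal R} (hm : m.IsMaximal) (u : Module.End R K)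
    (hu : LinearMap.range (u - 1) ≤ m • ⊤) :
    ∃ (v : Module.End R K) (s : R), s ∉ m ∧ v * u = s • 1 := by
  obtain ⟨p, hp, -, hpm, hpu⟩ :=
    LinearMap.exists_monic_and_natDegree_eq_and_coeff_mem_pow_and_aeval_eq_zero R (u - 1) m hu
  let q := p.comp (Polynomial.X - 1)
  have hq : Polynomial.aeval u q = 0 := by
    simp [q, Polynomial.aeval_comp, hpu]
  have hpX : p.map (Ideal.Quotient.mk m) = Polynomial.X ^ p.natDegree := by
    ext i
    rw [Polynomial.coeff_map, Polynomial.coeff_X_pow]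
    split_ifs with h
    · rw [h, hp.coeff_natDegree, map_one]
    · rw [Ideal.Quotient.eq_zero_iff_mem]
      obtain h' | h' := Nat.lt_or_gt_of_ne h
      · exact Ideal.pow_le_self (by omega) (hpm i)
      · rw [Polynomial.coeff_eq_zero_of_natDegree_lt h']
        exact zero_mem m
  refine ⟨Polynomial.aeval u q.divX, -q.coeff 0, fun h => ?_, ?_⟩
  · have h0 : Ideal.Quotient.mk m (q.coeff 0) = (-1) ^ p.natDegree := by
      rw [Polynomial.coeff_zero_eq_eval_zero, Polynomial.eval_comp]
      have := Polynomial.eval_map_apply (Ideal.Quotient.mk m) (-1 : R) (p := p)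
      rw [hpX] at this
      simpa using this.symm
    have hq0 : Ideal.Quotient.mk m (q.coeff 0) = 0 :=
      Ideal.Quotient.eq_zero_iff_mem.2 (neg_mem_iff.1 h)
    have := (isUnit_one (M := R ⧸ m)).neg.pow p.natDegree
    rw [← h0, hq0] at this
    have := Ideal.Quotient.nontrivial_iff.2 hm.ne_top
    exact not_isUnit_zero ‹_›
  · have h := congrArg (Polynomial.aeval u) q.divX_mul_X_add
    rw [hq, map_add, map_mul, Polynomial.aeval_X, Polynomial.aeval_C, add_eq_zero_iff_eq_neg] at h
    rw [h, neg_smul, Algebra.algebraMap_eq_smul_one]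

/-- If `Ext¹(C, R/m) = 0` then a finite module `C` over a Noetherian ring is projective near `m`. -/
lemma exists_smul_id_mem_range_of_subsingleton_ext [IsNoetherianRing R] (C : ModuleCat.{u} R)
    [Module.Finite R C] {m : Ideal R} (hm : m.IsMaximal)
    (hC : Subsingleton (Abelian.Ext C (ModuleCat.of R (R ⧸ m)) 1)) :
    ∃ s ∉ m, s • LinearMap.id ∈ LinearMap.range (dualTensorHom R C C) := by
  let := Ideal.Quotient.field m
  obtain ⟨n, p, hp⟩ := Module.Finite.exists_fin' R C
  let K := LinearMap.ker p
  let b := Module.finBasis (R ⧸ m) ((R ⧸ m) ⊗[R] K)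
  let e : (K ⧸ m • (⊤ : Submodule R K)) ≃ₗ[R] (Fin _ → R ⧸ m) :=
    (TensorProduct.quotTensorEquivQuotSMul K m).symm ≪≫ₗ b.equivFun.restrictScalars R
  let π := (m • (⊤ : Submodule R K)).mkQ
  -- Since `Ext¹` vanishes, each coordinate of `K → K/mK ≅ k^d` extends to `R^n`.
  choose g hg using fun i => exists_comp_eq_of_subsingleton_ext (N := ModuleCat.of R (R ⧸ m)) p hp
    (LinearMap.proj i ∘ₗ e.toLinearMap ∘ₗ π)
  -- Freeness lifts the extension to `σ : R^n → K`, a retraction onto `K` modulo `mK`.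
  obtain ⟨σ, hσ⟩ := Module.projective_lifting_property π (e.symm.toLinearMap ∘ₗ LinearMap.pi g)
    (Submodule.mkQ_surjective _)
  have hσπ (x : K) : π (σ x) = π x := by
    refine (LinearMap.congr_fun hσ x).trans ((LinearEquiv.symm_apply_eq _).2 (funext fun i => ?_))
    exact LinearMap.congr_fun (hg i) x
  obtain ⟨v, s, hs, hv⟩ := exists_aeval_mul_eq_of_range_sub_one_le hm (σ ∘ₗ K.subtype) (by
    rintro _ ⟨x, rfl⟩
    refine (Submodule.Quotient.mk_eq_zero _).1 ?_
    exact (map_sub π _ _).trans (sub_eq_zero.2 (hσπ x)))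
  -- `s - v σ` vanishes on `K`, so it descends to `ψ : C → R^n`. Since `v σ` lands in `K = ker p`,
  -- `p ψ = s`, and `s • id` factors through `R^n`.
  obtain ⟨ψ, hψ⟩ := exists_linearMap_of_smul_mem_range p
    (s • LinearMap.id - K.subtype ∘ₗ v ∘ₗ σ) (fun x hx => by
      have : v (σ x) = s • ⟨x, hx⟩ := LinearMap.congr_fun hv ⟨x, hx⟩
      simp [this]) 1 (fun x => hp _)
  refine ⟨s, hs, ∑ i, (LinearMap.proj i ∘ₗ ψ) ⊗ₜ p (Pi.single i 1), LinearMap.ext fun c => ?_⟩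
  have hc : p (ψ c) = s • c := by
    obtain ⟨x, rfl⟩ := hp c
    rw [hψ (p x) x (one_smul _ _).symm]
    simp only [LinearMap.sub_apply, map_sub, LinearMap.smul_apply, LinearMap.id_apply, map_smul]
    exact (congrArg (s • p x - ·) (v (σ x)).2).trans (sub_zero _)
  simp only [map_sum, LinearMap.sum_apply, dualTensorHom_apply, LinearMap.smul_apply,
    LinearMap.id_apply, ← hc]
  conv_rhs => rw [pi_eq_sum_univ' (ψ c)]
  simp [map_sum]

end Ext

end RelExt

/-! ### From semidualizing to invertible, and the equivalences. -/

namespace RelExt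

variable {R : Type u} [CommRing R] {C : ModuleCat.{u} R}

lemma IsSemidualizing.faithfulSMul (hC : IsSemidualizing C) : FaithfulSMul R C :=
  ⟨fun h => hC.homothety_bijective.1 (LinearMap.ext h)⟩

lemma IsSemidualizing.invertible_of_projective (hC : IsSemidualizing C) [Module.Projective R C] :
    Module.Invertible R C := by
  have := hC.finite
  exact .right (dualTensorHomEquiv R C C ≪≫ₗ
    (LinearEquiv.ofBijective _ hC.homothety_bijective).symm)

lemma picEquiv_self_of_invertible [Module.Invertible R C] : PicEquiv C (ModuleCat.of R R) := by
  let e : C ⊗[R] Module.Dual R C ≃ₗ[R] R :=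
    TensorProduct.comm R _ _ ≪≫ₗ Module.Invertible.linearEquiv R C
  refine ⟨ModuleCat.of R (Module.Dual R C), inferInstanceAs (Module.Finite R (Module.Dual R C)),
    inferInstanceAs (Module.Projective R (Module.Dual R C)), fun p => ?_, ⟨e.symm⟩⟩
  have := p.nontrivial
  have h := congrFun (Module.rankAtStalk_eq_of_equiv e) p
  rw [Module.rankAtStalk_tensorProduct, Module.rankAtStalk_self] at h
  exact Nat.eq_one_of_mul_eq_one_left h

variable [IsNoetherianRing R]

/-- The common endpoint of (iv) and (viii): in degree zero both `Ext_{P_C}(C, -)` and `Ext(C, -)`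
are `Hom(C, -)`. -/
lemma IsSemidualizing.projective_of_forall_linearEquiv (hC : IsSemidualizing C)
    (h : ∀ m : Ideal R, m.IsMaximal →
      Nonempty ((C →ₗ[R] R ⧸ m) ≃ₗ[R] ExtIC C C (ModuleCat.of R (R ⧸ m)) 0)) :
    Module.Projective R C := by
  have := hC.finite
  have := hC.faithfulSMul
  refine projective_of_forall_maximal_exists_smul_id_mem_range fun m hm => ?_
  obtain ⟨e⟩ := h m hm
  obtain ⟨e'⟩ := hC.nonempty_extIC_zero_linearEquiv_hom C (ModuleCat.of R (R ⧸ m))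
  obtain ⟨c, hc⟩ := exists_forall_sub_smul_mem_of_linearEquiv hm (e ≪≫ₗ e')
  exact exists_smul_id_mem_range_of_cyclic_mod hm c hc

end RelExt

theorem corollary3p6 {R : Type u} [CommRing R] [IsNoetherianRing R]
    (C : ModuleCat.{u} R) (hC : RelExt.IsSemidualizing C) :
    List.TFAE [
      RelExt.PicEquiv C (ModuleCat.of R R),
      Module.Projective R C,
      ∀ (M N : ModuleCat.{u} R) (i : ℕ),
        Nonempty (RelExt.ExtPC C M N i ≃ₗ[R] RelExt.ExtIC C M N i),
      ∀ (m : Ideal R), m.IsMaximal → ∀ i : ℕ,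
        Nonempty (RelExt.ExtPC C C (ModuleCat.of R (R ⧸ m)) i ≃ₗ[R]
          RelExt.ExtIC C C (ModuleCat.of R (R ⧸ m)) i),
      ∀ (m : Ideal R), m.IsMaximal →
        Nonempty (RelExt.ExtPC C C (ModuleCat.of R (R ⧸ m)) 0 ≃ₗ[R]
          RelExt.ExtIC C C (ModuleCat.of R (R ⧸ m)) 0),
      ∀ (M N : ModuleCat.{u} R) (i : ℕ),
        Nonempty (RelExt.ExtPC C M N i ≃ₗ[R] CategoryTheory.Abelian.Ext M N i),
      ∀ (m : Ideal R), m.IsMaximal → ∀ i : ℕ,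
        Nonempty (RelExt.ExtPC C C (ModuleCat.of R (R ⧸ m)) i ≃ₗ[R]
          CategoryTheory.Abelian.Ext C (ModuleCat.of R (R ⧸ m)) i),
      ∀ (M N : ModuleCat.{u} R) (i : ℕ),
        Nonempty (RelExt.ExtIC C M N i ≃ₗ[R] CategoryTheory.Abelian.Ext M N i),
      ∀ (m : Ideal R), m.IsMaximal → ∀ i : ℕ,
        Nonempty (RelExt.ExtIC C C (ModuleCat.of R (R ⧸ m)) i ≃ₗ[R]
          CategoryTheory.Abelian.Ext C (ModuleCat.of R (R ⧸ m)) i)] := by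
  have := hC.finite
  tfae_have 1 → 2 := by
    rintro ⟨P, -, -, -, ⟨e⟩⟩
    have := Module.Invertible.left e.symm
    infer_instance
  tfae_have 2 → 1 := fun _ =>
    have := hC.invertible_of_projective
    RelExt.picEquiv_self_of_invertible
  tfae_have 2 → 6 := fun _ =>
    have := hC.invertible_of_projective
    RelExt.nonempty_extPC_linearEquiv_ext C
  tfae_have 2 → 8 := fun _ =>
    have := hC.invertible_of_projective
    RelExt.nonempty_extIC_linearEquiv_ext C
  tfae_have 2 → 3 := fun h M N i => by
    obtain ⟨e⟩ := tfae_2_to_6 h M N i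
    obtain ⟨e'⟩ := tfae_2_to_8 h M N i
    exact ⟨e ≪≫ₗ e'.symm⟩
  tfae_have 3 → 4 := fun h m _ i => h C _ i
  tfae_have 4 → 5 := fun h m hm => h m hm 0
  tfae_have 6 → 7 := fun h m _ i => h C _ i
  tfae_have 8 → 9 := fun h m _ i => h C _ i
  tfae_have 5 → 2 := fun h => hC.projective_of_forall_linearEquiv fun m hm => by
    obtain ⟨e⟩ := h m hm
    obtain ⟨e'⟩ := RelExt.nonempty_extPC_zero_linearEquiv_hom C (ModuleCat.of R (R ⧸ m))
    exact ⟨e'.symm ≪≫ₗ e⟩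
  tfae_have 9 → 2 := fun h => hC.projective_of_forall_linearEquiv fun m hm => by
    obtain ⟨e⟩ := h m hm 0
    exact ⟨(e ≪≫ₗ Abelian.Ext.linearEquiv₀ ≪≫ₗ ModuleCat.homLinearEquiv).symm⟩
  -- Degree zero carries no information here, both sides being `Hom(C, R/m)`; degree one is
  -- decisive.
  tfae_have 7 → 2 := fun h =>
    RelExt.projective_of_forall_maximal_exists_smul_id_mem_range fun m hm => by
      obtain ⟨e⟩ := h m hm 1
      have := RelExt.subsingleton_extPC_one C (ModuleCat.of R (R ⧸ m))
      exact RelExt.exists_smul_id_mem_range_of_subsingleton_ext C hm e.symm.toEquiv.subsingleton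
  tfae_finish
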